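/- For all real numbers $\delta,\varepsilon,\varepsilon'$ with $0<\delta<\tfrac12$ and $\varepsilon>0$ there are $\alpha,\beta>0$, $0<x_l\le x_h$ with $x_h^2\beta>3$, $c>0$, $0<\gamma<\tfrac12$ and an integer $n\ge 1$ for which the following holds. Consider one-dimensional Bayesian linear regression with prior $\theta\sim\mathcal N(0,\alpha^{-1})$ and model $y=\theta x+\xi$, $\xi\sim\mathcal N(0,\beta^{-1})$, on the domain $\mathcal D$ of all databases $D=((x_i,y_i))_{i=1}^n$ with $x_i,y_i>0$, $x_l\le x_i\le x_h$ and $|y_i/x_i-c|\le n^{\gamma}$ for every $i$. A randomized algorithm $M$ with real output is called $(\varepsilon,\delta)$-differentially private (DP) on $\mathcal D$ if $\Pr[M(D)\in S]\le e^{\varepsilon}\Pr[M(\hat D)\in S]+\delta$ for every measurable $S\subseteq\mathbb R$ and all $D,\hat D\in\mathcal D$ that differ in at most one record. 1. A single sample from the posterior $p(\theta\mid D)\propto p(\theta)\prod_{i=1}^n p(y_i\mid x_i,\theta)$ is $(\varepsilon,\delta)$-DP on $\mathcal D$. 2. There is an integer $T\ge 1$ such that the output $\theta_T$ of cyclic SGLD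 after $T$ iterations is not $(\varepsilon'',\delta)$-DP on $\mathcal D$ for any $\varepsilon''<\varepsilon'$. Here cyclic SGLD (batch size $1$, step size $\eta=2/(\alpha+n x_h^2\beta)^2$) draws $\theta_0\sim\mathcal N(0,\alpha^{-1})$ and a uniformly random permutation $\sigma$ of the $n$ records, independently, and iterates $$\theta_{j+1}=\theta_j+\frac{\eta}{2}\Big[\nabla_\theta\ln p(\theta_j)+n\,\nabla_\theta\ln p\big(y_{i_j}\mid x_{i_j},\theta_j\big)\Big]+\sqrt{\eta}\,\xi_j,$$ where $i_j$ runs cyclically through the records in the order $\sigma$ and the $\xi_j\sim\mathcal N(0,1)$ are independent of each other and of $(\theta_0,\sigma)$. -/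

import Mathlib

open MeasureTheory ProbabilityTheory
open scoped ENNReal NNReal

noncomputable section

/-- `(ε, δ)`-differential privacy on the domain `𝒟` of a randomized algorithm that maps a database
of `n` records to a random element of `Ω` (`M D` is the law of the output on `D`). Two databases
are neighbours if their Hamming distance is at most one. -/
def IsDP {n : ℕ} {R Ω : Type*} [DecidableEq R] [MeasurableSpace Ω]
    (M : (Fin n → R) → Measure Ω) (𝒟 : Set (Fin n → R)) (ε δ : ℝ) : Prop :=
  ∀ D ∈ 𝒟, ∀ D' ∈ 𝒟, hammingDist D D' ≤ 1 →
    ∀ S : Set Ω, MeasurableSet S →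
      M D S ≤ ENNReal.ofReal (Real.exp ε) * M D' S + ENNReal.ofReal δ

/-- Posterior law of a real parameter `θ` with prior density `prior` and likelihood `lik d θ` of the
record `d`: the law whose density is proportional to `prior θ * ∏ i, lik (D i) θ`. -/
def posteriorLaw {n : ℕ} {R : Type*} (prior : ℝ → ℝ) (lik : R → ℝ → ℝ) (D : Fin n → R) :
    Measure ℝ :=
  let w : ℝ → ℝ≥0∞ := fun θ => ENNReal.ofReal (prior θ * ∏ i, lik (D i) θ)
  (∫⁻ θ, w θ)⁻¹ • volume.withDensity w

/-- The SGLD update with step size `η` and batch size one, on a database of size `n`: the new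
parameter obtained from `θ` with the record `d` and the noise value `ξ`. -/
def sgldUpdate {R : Type*} (prior : ℝ → ℝ) (lik : R → ℝ → ℝ) (η : ℝ) (n : ℕ) (d : R)
    (θ ξ : ℝ) : ℝ :=
  θ + η / 2 * (deriv (fun t => Real.log (prior t)) θ
      + (n : ℝ) * deriv (fun t => Real.log (lik d t)) θ)
    + Real.sqrt η * ξ

/-- Law of the `j`-th iterate of SGLD when the records are used cyclically in the order
`σ 0, σ 1, …, σ (n - 1)`. The initial value is drawn from the prior, and each step uses a fresh
standard Gaussian noise independent of the past. -/
def sgldOrderLaw {n : ℕ} {R : Type*} (hn : 0 < n) (prior : ℝ → ℝ) (lik : R → ℝ → ℝ) (η : ℝ)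
    (D : Fin n → R) (σ : Equiv.Perm (Fin n)) : ℕ → Measure ℝ
  | 0 => volume.withDensity (fun θ => ENNReal.ofReal (prior θ))
  | j + 1 =>
    ((sgldOrderLaw hn prior lik η D σ j).prod (gaussianReal 0 1)).map
      (fun p => sgldUpdate prior lik η n (D (σ ⟨j % n, Nat.mod_lt j hn⟩)) p.1 p.2)

/-- Law of the output of cyclic SGLD after `T` iterations: the records are first put in a uniformly
random order, which is then used cyclically. -/
def cyclicSGLDLaw {n : ℕ} {R : Type*} (hn : 0 < n) (prior : ℝ → ℝ) (lik : R → ℝ → ℝ) (η : ℝ)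
    (T : ℕ) (D : Fin n → R) : Measure ℝ :=
  ((Nat.factorial n : ℕ) : ℝ≥0∞)⁻¹ •
    ∑ σ : Equiv.Perm (Fin n), sgldOrderLaw hn prior lik η D σ T

/-- Prior density of the slope, `θ ~ N(0, α⁻¹)`. -/
def slopePrior (α : ℝ) (θ : ℝ) : ℝ := gaussianPDFReal 0 (Real.toNNReal α⁻¹) θ

/-- Likelihood of the record `d = (x, y)` in the linear model `y = θ x + ξ`, `ξ ~ N(0, β⁻¹)`. -/
def slopeLik (β : ℝ) (d : ℝ × ℝ) (θ : ℝ) : ℝ :=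
  gaussianPDFReal (θ * d.1) (Real.toNNReal β⁻¹) d.2

/-- The restricted domain of databases of `n` records `(x, y)`. -/
def regressionDomain (n : ℕ) (γ xh xl c : ℝ) : Set (Fin n → ℝ × ℝ) :=
  {D | ∀ i, 0 < (D i).1 ∧ 0 < (D i).2 ∧ xl ≤ (D i).1 ∧ (D i).1 ≤ xh ∧
    |(D i).2 / (D i).1 - c| ≤ (n : ℝ) ^ γ}

end

/-! The witnesses are `α = β = 1`, inputs in `[1, 2]`, `n = N ^ 4`, `γ = 1/4` (so `n ^ γ = N`),
slope `c = N ^ 5`, `T = n`, with `N` large.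

The posterior is Gaussian with precision `P = 1 + ∑ x_i ^ 2` between `N ^ 4` and `5 N ^ 4`. Its mean
is `c - c / P + U / P`, where `U` collects the deviations from the line of slope `c`. Changing one
record moves `P` by at most 3 and the mean by `O(N ^ (-3))`, against a standard deviation of order
`N ^ (-2)`. Away from a Chebyshev tail of mass at most `δ`, the privacy loss is thus `O(1 / N)`
(`gaussian_privacyLoss_le`, `isDP_posteriorLaw_slope`).

SGLD starts at mean 0, at distance `c` from the slope, and one pass over the data removes only a
constant fraction of this distance. Changing one record changes one contraction rate by order `1 /
n`, so the mean moves by order `c / n = N`, whatever the order of the records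
(`sgldMean_line_sub_ge`). The variance stays at most 2, so a half-line separates the two output laws
(`not_isDP_cyclicSGLDLaw_slope`). -/

/-! ### Gaussian measures: density ratios, tails, affine images. -/

theorem gaussianPDFReal_inv_precision {P : ℝ} (hP : 0 < P) (m x : ℝ) :
    gaussianPDFReal m (Real.toNNReal P⁻¹) x =
      (√(2 * Real.pi * P⁻¹))⁻¹ * Real.exp (-(P / 2) * (x - m) ^ 2) := by
  rw [gaussianPDFReal, Real.coe_toNNReal _ (inv_nonneg.2 hP.le)]
  congr 2
  field_simp

/-- The ratio of normalising constants is `√(P / P')`, and `1 + u ≤ exp u` turns it into the summand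
`(P / P' - 1) / 2` of the exponent. -/
theorem gaussianPDFReal_le_exp_mul {P P' m m' ε x : ℝ} (hP : 0 < P) (hP' : 0 < P')
    (h : (P / P' - 1) / 2 + P' / 2 * (x - m') ^ 2 - P / 2 * (x - m) ^ 2 ≤ ε) :
    gaussianPDFReal m (Real.toNNReal P⁻¹) x ≤
      Real.exp ε * gaussianPDFReal m' (Real.toNNReal P'⁻¹) x := by
  have hpi := Real.pi_pos
  rw [gaussianPDFReal_inv_precision hP, gaussianPDFReal_inv_precision hP']
  have hs : √(2 * Real.pi * P'⁻¹) = √(2 * Real.pi * P⁻¹) * √(P / P') := by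
    rw [← Real.sqrt_mul (by positivity)]
    congr 1
    field_simp
  have hr : √(P / P') ≤ Real.exp ((P / P' - 1) / 2) := by
    rw [Real.sqrt_le_left (Real.exp_pos _).le, ← Real.exp_nat_mul]
    have := Real.add_one_le_exp (P / P' - 1)
    push_cast
    rw [mul_div_cancel₀ _ (by norm_num)]
    linarith
  have hpos : 0 < √(P / P') := Real.sqrt_pos.2 (div_pos hP hP')
  rw [hs]
  calc (√(2 * Real.pi * P⁻¹))⁻¹ * Real.exp (-(P / 2) * (x - m) ^ 2)
      ≤ (√(2 * Real.pi * P⁻¹))⁻¹ * (Real.exp (ε - P' / 2 * (x - m') ^ 2) *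
          (Real.exp ((P / P' - 1) / 2))⁻¹) := by
        rw [← Real.exp_neg, ← Real.exp_add]
        gcongr
        linarith
    _ ≤ (√(2 * Real.pi * P⁻¹))⁻¹ * (Real.exp (ε - P' / 2 * (x - m') ^ 2) * (√(P / P'))⁻¹) := by
        gcongr
    _ = _ := by
        rw [sub_eq_add_neg, Real.exp_add, neg_mul, mul_inv]
        ring

theorem gaussianReal_compl_ball_le (m : ℝ) (v : ℝ≥0) {t : ℝ} (ht : 0 < t) :
    gaussianReal m v {x | t ≤ |x - m|} ≤ ENNReal.ofReal (v / t ^ 2) := by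
  have h := meas_ge_le_variance_div_sq (memLp_id_gaussianReal (μ := m) (v := v) 2) ht
  simpa [integral_id_gaussianReal, variance_id_gaussianReal] using h

/-- Within `K` standard deviations of `m` the densities are compared pointwise; the rest has mass at
most `1 / K ^ 2` by Chebyshev and is absorbed by `δ`. -/
theorem gaussianReal_le_exp_mul_add {P P' m m' ε δ K : ℝ} (hP : 0 < P) (hP' : 0 < P')
    (hK : 0 < K) (hδ : (K ^ 2)⁻¹ ≤ δ)
    (h : ∀ t : ℝ, P * t ^ 2 ≤ K ^ 2 →
      (P / P' - 1) / 2 + P' / 2 * (t + (m - m')) ^ 2 - P / 2 * t ^ 2 ≤ ε)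
    {S : Set ℝ} (hS : MeasurableSet S) :
    gaussianReal m (Real.toNNReal P⁻¹) S ≤
      ENNReal.ofReal (Real.exp ε) * gaussianReal m' (Real.toNNReal P'⁻¹) S +
        ENNReal.ofReal δ := by
  have hv : Real.toNNReal P⁻¹ ≠ 0 := by simpa using hP
  have hv' : Real.toNNReal P'⁻¹ ≠ 0 := by simpa using hP'
  set r : ℝ := K / √P with hr
  have hrpos : 0 < r := by positivity
  have hr2 : r ^ 2 = K ^ 2 / P := by rw [hr, div_pow, Real.sq_sqrt hP.le]
  set B : Set ℝ := {x | r ≤ |x - m|} with hB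
  have hBm : MeasurableSet B := measurableSet_le measurable_const (by fun_prop)
  have htail : gaussianReal m (Real.toNNReal P⁻¹) B ≤ ENNReal.ofReal δ := by
    refine (gaussianReal_compl_ball_le m _ hrpos).trans (ENNReal.ofReal_le_ofReal ?_)
    rw [hr2, Real.coe_toNNReal _ (inv_nonneg.2 hP.le)]
    refine le_trans (le_of_eq ?_) hδ
    field_simp
  have hmain : gaussianReal m (Real.toNNReal P⁻¹) (S \ B) ≤
      ENNReal.ofReal (Real.exp ε) * gaussianReal m' (Real.toNNReal P'⁻¹) S := by
    rw [gaussianReal_apply _ hv, gaussianReal_apply _ hv',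
      ← lintegral_const_mul _ (measurable_gaussianPDF _ _)]
    refine (setLIntegral_mono' (hS.diff hBm) fun x hx => ?_).trans
      (lintegral_mono_set Set.sdiff_subset)
    rw [gaussianPDF, gaussianPDF, ← ENNReal.ofReal_mul (Real.exp_pos _).le]
    refine ENNReal.ofReal_le_ofReal (gaussianPDFReal_le_exp_mul hP hP' ?_)
    have hx2 : |x - m| < r := by simpa [hB] using hx.2
    have := h (x - m) ?_
    · rwa [sub_add_sub_cancel] at this
    · have h2 : (x - m) ^ 2 ≤ r ^ 2 := sq_le_sq.2 (by rw [abs_of_pos hrpos]; exact hx2.le)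
      rw [hr2, le_div_iff₀ hP] at h2
      linarith
  calc gaussianReal m (Real.toNNReal P⁻¹) S
      ≤ gaussianReal m (Real.toNNReal P⁻¹) ((S \ B) ∪ B) := measure_mono (by
        rw [Set.sdiff_union_self]; exact Set.subset_union_left)
    _ ≤ _ := (measure_union_le _ _).trans (add_le_add hmain htail)

theorem map_affine_prod_gaussianReal (m : ℝ) (v : ℝ≥0) (a b s : ℝ) :
    ((gaussianReal m v).prod (gaussianReal 0 1)).map (fun p => a * p.1 + b + s * p.2) =
      gaussianReal (a * m + b) (NNReal.mk (a ^ 2) (sq_nonneg a) * v +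
        NNReal.mk (s ^ 2) (sq_nonneg s)) := by
  have h1 : (gaussianReal m v).map (fun x => a * x + b) =
      gaussianReal (a * m + b) (NNReal.mk (a ^ 2) (sq_nonneg a) * v) := by
    rw [← gaussianReal_map_add_const, ← gaussianReal_map_const_mul,
      Measure.map_map (by fun_prop) (by fun_prop)]
    rfl
  have h2 : (gaussianReal 0 1).map (fun x => s * x) =
      gaussianReal 0 (NNReal.mk (s ^ 2) (sq_nonneg s)) := by
    rw [gaussianReal_map_const_mul]; simp
  have h := gaussianReal_conv_gaussianReal (m₁ := a * m + b) (m₂ := 0)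
    (v₁ := NNReal.mk (a ^ 2) (sq_nonneg a) * v) (v₂ := NNReal.mk (s ^ 2) (sq_nonneg s))
  rw [add_zero] at h
  rw [← h, ← h1, ← h2, Measure.conv, Measure.map_prod_map _ _ (by fun_prop) (by fun_prop),
    Measure.map_map (by fun_prop) (by fun_prop)]
  rfl

/-! ### The linear model: SGLD iterates and posterior are Gaussian. -/

theorem slopePrior_eq {α : ℝ} (hα : 0 < α) (θ : ℝ) :
    slopePrior α θ = (√(2 * Real.pi * α⁻¹))⁻¹ * Real.exp (-(α / 2) * θ ^ 2) := by
  rw [slopePrior, gaussianPDFReal_inv_precision hα, sub_zero]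

theorem slopeLik_eq {β : ℝ} (hβ : 0 < β) (d : ℝ × ℝ) (θ : ℝ) :
    slopeLik β d θ =
      (√(2 * Real.pi * β⁻¹))⁻¹ * Real.exp (-(β / 2) * (d.2 - θ * d.1) ^ 2) := by
  rw [slopeLik, gaussianPDFReal_inv_precision hβ]

theorem deriv_log_slopePrior {α : ℝ} (hα : 0 < α) (θ : ℝ) :
    deriv (fun t => Real.log (slopePrior α t)) θ = -α * θ := by
  have hpi := Real.pi_pos
  have h : (fun t => Real.log (slopePrior α t)) =
      fun t => Real.log (√(2 * Real.pi * α⁻¹))⁻¹ + -(α / 2) * t ^ 2 := by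
    ext t
    rw [slopePrior_eq hα, Real.log_mul (by positivity) (Real.exp_pos _).ne', Real.log_exp]
  rw [h]
  have h2 := ((hasDerivAt_pow 2 θ).const_mul (-(α / 2))).const_add
    (Real.log (√(2 * Real.pi * α⁻¹))⁻¹)
  rw [h2.deriv]
  push_cast
  ring

theorem deriv_log_slopeLik {β : ℝ} (hβ : 0 < β) (d : ℝ × ℝ) (θ : ℝ) :
    deriv (fun t => Real.log (slopeLik β d t)) θ = β * d.1 * (d.2 - θ * d.1) := by
  have hpi := Real.pi_pos
  have h : (fun t => Real.log (slopeLik β d t)) =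
      fun t => Real.log (√(2 * Real.pi * β⁻¹))⁻¹ + -(β / 2) * (d.2 - t * d.1) ^ 2 := by
    ext t
    rw [slopeLik_eq hβ, Real.log_mul (by positivity) (Real.exp_pos _).ne', Real.log_exp]
  rw [h]
  have h2 := (((((hasDerivAt_id θ).mul_const d.1).const_sub d.2).pow 2).const_mul
    (-(β / 2))).const_add (Real.log (√(2 * Real.pi * β⁻¹))⁻¹)
  refine h2.deriv.trans ?_
  simp
  ring

theorem sgldUpdate_slope {α β : ℝ} (hα : 0 < α) (hβ : 0 < β) (η : ℝ) (n : ℕ) (d : ℝ × ℝ)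
    (θ ξ : ℝ) :
    sgldUpdate (slopePrior α) (slopeLik β) η n d θ ξ =
      (1 - η / 2 * (α + n * β * d.1 ^ 2)) * θ + η / 2 * (n * β * d.1 * d.2) + √η * ξ := by
  rw [sgldUpdate, deriv_log_slopePrior hα, deriv_log_slopeLik hβ]
  ring

/-- Mean of the `j`-th iterate of SGLD for the linear model with the records `d 0, d 1, …`. -/
noncomputable def sgldMean (α β η : ℝ) (n : ℕ) (d : ℕ → ℝ × ℝ) : ℕ → ℝ
  | 0 => 0
  | j + 1 => (1 - η / 2 * (α + n * β * (d j).1 ^ 2)) * sgldMean α β η n d j +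
      η / 2 * (n * β * (d j).1 * (d j).2)

/-- Each update is affine in the iterate plus independent Gaussian noise. Since the rates lie in
`[0, 1]`, the linear part does not increase the variance, and a step adds at most `η`. -/
theorem exists_sgldOrderLaw_eq_gaussianReal {n : ℕ} (hn : 0 < n) {α β η : ℝ} (hα : 0 < α)
    (hβ : 0 < β) (hη : 0 ≤ η) (D : Fin n → ℝ × ℝ)
    (hD : ∀ i, η / 2 * (α + n * β * (D i).1 ^ 2) ≤ 1) (σ : Equiv.Perm (Fin n)) (j : ℕ) :
    ∃ v : ℝ≥0, (v : ℝ) ≤ α⁻¹ + j * η ∧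
      sgldOrderLaw hn (slopePrior α) (slopeLik β) η D σ j =
        gaussianReal (sgldMean α β η n (fun k => D (σ ⟨k % n, Nat.mod_lt k hn⟩)) j) v := by
  induction j with
  | zero =>
    refine ⟨Real.toNNReal α⁻¹, by simp [hα.le], ?_⟩
    rw [sgldOrderLaw, sgldMean, gaussianReal_of_var_ne_zero _ (by simpa using hα)]
    rfl
  | succ j ih =>
    obtain ⟨v, hv, h⟩ := ih
    set d := D (σ ⟨j % n, Nat.mod_lt j hn⟩) with hd
    have hl := hD (σ ⟨j % n, Nat.mod_lt j hn⟩)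
    rw [← hd] at hl
    have hl0 : 0 ≤ η / 2 * (α + n * β * d.1 ^ 2) := by positivity
    refine ⟨NNReal.mk ((1 - η / 2 * (α + n * β * d.1 ^ 2)) ^ 2) (sq_nonneg _) * v +
      NNReal.mk (√η ^ 2) (sq_nonneg _), ?_, ?_⟩
    · simp only [NNReal.coe_add, NNReal.coe_mul, NNReal.coe_mk, Real.sq_sqrt hη]
      push_cast
      have h1 : (1 - η / 2 * (α + n * β * d.1 ^ 2)) ^ 2 ≤ 1 := by
        apply pow_le_one₀ <;> linarith
      nlinarith [mul_le_mul_of_nonneg_right h1 v.2]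
    · rw [sgldOrderLaw, h, sgldMean, ← map_affine_prod_gaussianReal]
      congr 1
      ext p
      exact sgldUpdate_slope hα hβ η n _ _ _

theorem posteriorLaw_slope {n : ℕ} {α β : ℝ} (hα : 0 < α) (hβ : 0 < β) (D : Fin n → ℝ × ℝ) :
    posteriorLaw (slopePrior α) (slopeLik β) D =
      gaussianReal (β * (∑ i, (D i).1 * (D i).2) / (α + β * ∑ i, (D i).1 ^ 2))
        (Real.toNNReal (α + β * ∑ i, (D i).1 ^ 2)⁻¹) := by
  have hpi := Real.pi_pos
  set P := α + β * ∑ i, (D i).1 ^ 2 with hPdef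
  set q := ∑ i, (D i).1 * (D i).2 with hq
  have hP : 0 < P := by
    have : 0 ≤ ∑ i, (D i).1 ^ 2 := Finset.sum_nonneg fun i _ => sq_nonneg _
    positivity
  obtain ⟨C, hC, hw⟩ : ∃ C : ℝ, 0 < C ∧ ∀ θ, slopePrior α θ * ∏ i, slopeLik β (D i) θ =
      C * gaussianPDFReal (β * q / P) (Real.toNNReal P⁻¹) θ := by
    -- The constant is what remains after completing the square in `θ`; it cancels in the
    -- normalisation.
    refine ⟨(√(2 * Real.pi * α⁻¹))⁻¹ * (√(2 * Real.pi * β⁻¹))⁻¹ ^ n *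
      Real.exp ((β * q) ^ 2 / (2 * P) - β / 2 * ∑ i, (D i).2 ^ 2) * √(2 * Real.pi * P⁻¹),
      by positivity, fun θ => ?_⟩
    simp only [slopePrior_eq hα, slopeLik_eq hβ, Finset.prod_mul_distrib, Finset.prod_const,
      Finset.card_univ, Fintype.card_fin, gaussianPDFReal_inv_precision hP, ← Real.exp_sum]
    have hs : √(2 * Real.pi * P⁻¹) ≠ 0 := by positivity
    have hsum : ∑ i, -(β / 2) * ((D i).2 - θ * (D i).1) ^ 2 =
        -(β / 2) * ∑ i, (D i).2 ^ 2 + β * θ * q - β / 2 * θ ^ 2 * ∑ i, (D i).1 ^ 2 := by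
      rw [hq]
      simp only [Finset.mul_sum, ← Finset.sum_add_distrib, ← Finset.sum_sub_distrib]
      exact Finset.sum_congr rfl fun i _ => by ring
    have he : -(α / 2) * θ ^ 2 + ∑ i, -(β / 2) * ((D i).2 - θ * (D i).1) ^ 2 =
        ((β * q) ^ 2 / (2 * P) - β / 2 * ∑ i, (D i).2 ^ 2) +
          -(P / 2) * (θ - β * q / P) ^ 2 := by
      have h3 : -(P / 2) * (θ - β * q / P) ^ 2 =
          -(P / 2) * θ ^ 2 + β * q * θ - (β * q) ^ 2 / (2 * P) := by
        field_simp
        ring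
      rw [hsum, h3, hPdef]
      ring
    have he' := congrArg Real.exp he
    rw [Real.exp_add, Real.exp_add] at he'
    rw [mul_mul_mul_comm, he']
    field_simp
  have hv : Real.toNNReal P⁻¹ ≠ 0 := by simpa using hP
  have hfun : (fun θ => ENNReal.ofReal (slopePrior α θ * ∏ i, slopeLik β (D i) θ)) =
      ENNReal.ofReal C • gaussianPDF (β * q / P) (Real.toNNReal P⁻¹) := by
    ext θ
    rw [hw, ENNReal.ofReal_mul hC.le]
    rfl
  have hC0 : ENNReal.ofReal C ≠ 0 := by simpa using hC
  have hint : ∫⁻ θ, ENNReal.ofReal (slopePrior α θ * ∏ i, slopeLik β (D i) θ) =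
      ENNReal.ofReal C := by
    rw [hfun]
    refine (lintegral_const_mul _ (measurable_gaussianPDF _ _)).trans ?_
    rw [lintegral_gaussianPDF_eq_one _ hv, mul_one]
  simp only [posteriorLaw]
  rw [hint, hfun, withDensity_smul _ (measurable_gaussianPDF _ _),
    ← gaussianReal_of_var_ne_zero _ hv, smul_smul,
    ENNReal.inv_mul_cancel hC0 ENNReal.ofReal_ne_top, one_smul]

/-! ### Privacy of a posterior sample. -/

theorem abs_sum_sub_sum_le_of_hammingDist_le_one {n : ℕ} {R : Type*} [DecidableEq R]
    {D D' : Fin n → R} (h : hammingDist D D' ≤ 1) (f : R → ℝ) {B : ℝ} (hB : 0 ≤ B)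
    (hf : ∀ i, |f (D i) - f (D' i)| ≤ B) :
    |∑ i, f (D i) - ∑ i, f (D' i)| ≤ B := by
  classical
  rw [← Finset.sum_sub_distrib, ← Finset.sum_filter_of_ne (p := fun i => D i ≠ D' i)
    (fun i _ hi heq => hi (by rw [heq, sub_self]))]
  refine (Finset.abs_sum_le_sum_abs _ _).trans ?_
  refine (Finset.sum_le_card_nsmul _ _ B fun i _ => hf i).trans ?_
  rw [nsmul_eq_mul]
  have : ((Finset.univ.filter fun i => D i ≠ D' i).card : ℝ) ≤ 1 := by exact_mod_cast h
  nlinarith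

/-- The privacy loss of two Gaussian posteriors of precision of order `N ^ 4` whose means are
`14 / N ^ 3` apart. -/
theorem gaussian_privacyLoss_le {N P P' Δ t K ε : ℝ} (hN : 1 ≤ N) (hK : 0 < K)
    (hε : (K ^ 2 + 70 * K + 500) / N ≤ ε * 2⁻¹)
    (hP : N ^ 4 ≤ P) (hP' : N ^ 4 ≤ P') (hP'2 : P' ≤ 5 * N ^ 4) (hPP : |P - P'| ≤ 3)
    (hΔ : N ^ 3 * |Δ| ≤ 14) (ht : P * t ^ 2 ≤ K ^ 2) :
    (P / P' - 1) / 2 + P' / 2 * (t + Δ) ^ 2 - P / 2 * t ^ 2 ≤ ε := by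
  have hN0 : 0 < N := by linarith
  have hN4 : N ≤ N ^ 4 := le_self_pow₀ hN (by norm_num)
  have hPp : 0 < P := by linarith
  have hP'p : 0 < P' := by linarith
  obtain ⟨hl, hu⟩ := abs_le.1 hPP
  have ht2 : (N ^ 2 * |t|) ^ 2 ≤ K ^ 2 := by
    rw [mul_pow, sq_abs, ← pow_mul]
    exact (mul_le_mul_of_nonneg_right hP (sq_nonneg t)).trans ht
  have ht1 : N ^ 2 * |t| ≤ K := le_of_sq_le_sq ht2 hK.le
  -- The loss splits into normalisation, change of precision, cross term and squared mean shift,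
  -- each `O(1 / N)` because `|t| ≤ K / N ^ 2` and `|Δ| ≤ 14 / N ^ 3`.
  have e1 : (P / P' - 1) / 2 ≤ 3 / 2 / N := by
    rw [div_sub_one hP'p.ne', div_div, div_div, div_le_div_iff₀ (by positivity) (by positivity)]
    nlinarith
  have e2 : (P' - P) / 2 * t ^ 2 ≤ 3 / 2 * K ^ 2 / N := by
    rw [le_div_iff₀ hN0]
    have h1 : N * t ^ 2 ≤ K ^ 2 :=
      (mul_le_mul_of_nonneg_right (hN4.trans hP) (sq_nonneg t)).trans ht
    have h2 : (P' - P) * (t ^ 2 * N) ≤ 3 * (t ^ 2 * N) :=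
      mul_le_mul_of_nonneg_right (by linarith) (by positivity)
    linarith
  have e3 : P' * (t * Δ) ≤ 70 * K / N := by
    rw [le_div_iff₀ hN0]
    have h1 : t * Δ ≤ |t| * |Δ| := (le_abs_self _).trans (abs_mul _ _).le
    have h2 : (N ^ 2 * |t|) * (N ^ 3 * |Δ|) ≤ K * 14 :=
      mul_le_mul ht1 hΔ (by positivity) hK.le
    have h3 : P' * (t * Δ) ≤ 5 * N ^ 4 * (|t| * |Δ|) :=
      (mul_le_mul_of_nonneg_left h1 hP'p.le).trans
        (mul_le_mul_of_nonneg_right hP'2 (by positivity))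
    nlinarith
  have e4 : P' / 2 * Δ ^ 2 ≤ 490 / N := by
    rw [le_div_iff₀ hN0]
    have h1 : (N ^ 3 * |Δ|) ^ 2 ≤ 14 ^ 2 := pow_le_pow_left₀ (by positivity) hΔ 2
    rw [mul_pow, sq_abs] at h1
    have h2 : N ^ 5 ≤ N ^ 6 := pow_le_pow_right₀ hN (by norm_num)
    have h3 : P' / 2 * Δ ^ 2 * N ≤ 5 / 2 * (N ^ 6 * Δ ^ 2) := by
      nlinarith [mul_nonneg (sq_nonneg Δ) hN0.le,
        mul_le_mul_of_nonneg_right h2 (sq_nonneg Δ),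
        mul_le_mul_of_nonneg_right hP'2 (mul_nonneg (sq_nonneg Δ) hN0.le)]
    nlinarith
  have e5 : (3 / 2 + 3 / 2 * K ^ 2 + 70 * K + 490) / N ≤ ε := by
    refine le_trans ?_ (show 2 * ((K ^ 2 + 70 * K + 500) / N) ≤ ε by linarith)
    rw [← mul_div_assoc]
    gcongr
    nlinarith [sq_nonneg K]
  have e6 : (3 / 2 + 3 / 2 * K ^ 2 + 70 * K + 490) / N =
    3 / 2 / N + 3 / 2 * K ^ 2 / N + 70 * K / N + 490 / N := by ring
  nlinarith

/-- Difference of the posterior means `(c * (P - 1) + U) / P`, where `c = N ^ 5`. -/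
theorem abs_posteriorMean_sub_le {N P P' U U' : ℝ} (hN : 1 ≤ N)
    (hP : N ^ 4 ≤ P) (hP' : N ^ 4 ≤ P') (hPP : |P - P'| ≤ 3)
    (hU : |U - U'| ≤ 8 * N) (hU' : |U'| ≤ P' * N) :
    N ^ 3 * |((N ^ 5 * (P - 1) + U) / P - (N ^ 5 * (P' - 1) + U') / P')| ≤ 14 := by
  have hN0 : 0 < N := by linarith
  have hN4 : 0 < N ^ 4 := by positivity
  have hPp : 0 < P := by linarith
  have hP'p : 0 < P' := by linarith
  -- The large constant `N ^ 5` cancels, leaving only its multiple of `1 / P' - 1 / P`. The three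
  -- terms contribute 3, 8 and 3.
  have hid : (N ^ 5 * (P - 1) + U) / P - (N ^ 5 * (P' - 1) + U') / P' =
      N ^ 5 * (P - P') / (P * P') + (U - U') / P - U' / P' * ((P - P') / P) := by
    field_simp
    ring
  have a1 : |N ^ 5 * (P - P') / (P * P')| ≤ 3 / N ^ 3 := by
    rw [abs_div, abs_mul, abs_of_pos (mul_pos hPp hP'p), abs_of_pos (pow_pos hN0 5)]
    calc _ ≤ N ^ 5 * 3 / (N ^ 4 * N ^ 4) := by gcongr
      _ = _ := by field_simp
  have a2 : |(U - U') / P| ≤ 8 / N ^ 3 := by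
    rw [abs_div, abs_of_pos hPp]
    calc _ ≤ 8 * N / N ^ 4 := by gcongr
      _ = _ := by field_simp
  have a3 : |U' / P' * ((P - P') / P)| ≤ 3 / N ^ 3 := by
    rw [abs_mul, abs_div, abs_div, abs_of_pos hPp, abs_of_pos hP'p]
    have : |U'| / P' ≤ N := by rw [div_le_iff₀ hP'p]; linarith
    calc _ ≤ N * (3 / N ^ 4) := by gcongr
      _ = _ := by field_simp
  rw [hid, mul_comm, ← le_div_iff₀ (by positivity)]
  calc _ ≤ 3 / N ^ 3 + 8 / N ^ 3 + 3 / N ^ 3 :=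
        (abs_sub _ _).trans (add_le_add ((abs_add_le _ _).trans (add_le_add a1 a2)) a3)
    _ = _ := by ring

theorem isDP_posteriorLaw_slope {N n : ℕ} (hN : 1 ≤ N) (hn : n = N ^ 4) {γ δ ε K : ℝ}
    (hγ : (n : ℝ) ^ γ = N) (hK : 0 < K) (hδ : (K ^ 2)⁻¹ ≤ δ)
    (hε : (K ^ 2 + 70 * K + 500) / N ≤ ε * 2⁻¹) :
    IsDP (posteriorLaw (slopePrior 1) (slopeLik 1)) (regressionDomain n γ 2 1 ((N : ℝ) ^ 5))
      ε δ := by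
  have hN1 : (1 : ℝ) ≤ N := by exact_mod_cast hN
  have hnN : (n : ℝ) = (N : ℝ) ^ 4 := by rw [hn]; push_cast; rfl
  have hsq : ∀ D ∈ regressionDomain n γ 2 1 ((N : ℝ) ^ 5), ∀ i,
      1 ≤ (D i).1 ^ 2 ∧ (D i).1 ^ 2 ≤ 4 ∧
      |(D i).1 * (D i).2 - (N : ℝ) ^ 5 * (D i).1 ^ 2| ≤ (D i).1 ^ 2 * N := by
    intro D hD i
    obtain ⟨h1, -, h2, h3, h4⟩ := hD i
    rw [hγ] at h4
    refine ⟨by nlinarith, by nlinarith, ?_⟩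
    have : (D i).1 * (D i).2 - (N : ℝ) ^ 5 * (D i).1 ^ 2 =
        (D i).1 ^ 2 * ((D i).2 / (D i).1 - (N : ℝ) ^ 5) := by field_simp
    rw [this, abs_mul, abs_of_nonneg (sq_nonneg _)]
    gcongr
  have hP : ∀ D ∈ regressionDomain n γ 2 1 ((N : ℝ) ^ 5),
      (N : ℝ) ^ 4 ≤ 1 + 1 * ∑ i, (D i).1 ^ 2 ∧ 1 + 1 * ∑ i, (D i).1 ^ 2 ≤ 5 * (N : ℝ) ^ 4 := by
    intro D hD
    have h1 := Finset.card_nsmul_le_sum Finset.univ (fun i => (D i).1 ^ 2) 1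
      fun i _ => (hsq D hD i).1
    have h2 := Finset.sum_le_card_nsmul Finset.univ (fun i => (D i).1 ^ 2) 4
      fun i _ => (hsq D hD i).2.1
    simp only [Finset.card_univ, Fintype.card_fin, nsmul_eq_mul, hnN] at h1 h2
    have : (1 : ℝ) ≤ (N : ℝ) ^ 4 := one_le_pow₀ hN1
    constructor <;> linarith
  -- Splitting `x y` into `c x ^ 2` and a deviation of size at most `4 N` isolates the part
  -- proportional to `P - 1`.
  have hmean : ∀ D : Fin n → ℝ × ℝ, 1 * ∑ i, (D i).1 * (D i).2 =
      (N : ℝ) ^ 5 * (1 + 1 * ∑ i, (D i).1 ^ 2 - 1) +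
        ∑ i, ((D i).1 * (D i).2 - (N : ℝ) ^ 5 * (D i).1 ^ 2) := by
    intro D
    rw [Finset.sum_sub_distrib, ← Finset.mul_sum]
    ring
  intro D hD D' hD' hdist S hS
  rw [posteriorLaw_slope one_pos one_pos, posteriorLaw_slope one_pos one_pos, hmean D, hmean D']
  have hPP : |(1 + 1 * ∑ i, (D i).1 ^ 2) - (1 + 1 * ∑ i, (D' i).1 ^ 2)| ≤ 3 := by
    have := abs_sum_sub_sum_le_of_hammingDist_le_one hdist (fun d : ℝ × ℝ => d.1 ^ 2)
      (B := 3) (by norm_num) (fun i => by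
        have h1 := hsq D hD i
        have h2 := hsq D' hD' i
        rw [abs_le]
        constructor <;> linarith)
    simpa using this
  have hU := abs_sum_sub_sum_le_of_hammingDist_le_one hdist
      (fun d : ℝ × ℝ => d.1 * d.2 - (N : ℝ) ^ 5 * d.1 ^ 2)
      (B := 8 * N) (by positivity) (fun i => by
        have h1 := (hsq D hD i).2
        have h2 := (hsq D' hD' i).2
        have h3 := abs_le.1 h1.2
        have h4 := abs_le.1 h2.2
        rw [abs_le]
        constructor <;> nlinarith)
  have hU' : |∑ i, ((D' i).1 * (D' i).2 - (N : ℝ) ^ 5 * (D' i).1 ^ 2)| ≤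
      (1 + 1 * ∑ i, (D' i).1 ^ 2) * N := by
    refine (Finset.abs_sum_le_sum_abs _ _).trans
      ((Finset.sum_le_sum fun i _ => (hsq D' hD' i).2.2).trans ?_)
    rw [← Finset.sum_mul]
    nlinarith
  have hpos : (0 : ℝ) < (N : ℝ) ^ 4 := by positivity
  exact gaussianReal_le_exp_mul_add (hpos.trans_le (hP D hD).1) (hpos.trans_le (hP D' hD').1)
    hK hδ (fun t ht => gaussian_privacyLoss_le hN1 hK hε (hP D hD).1 (hP D' hD').1 (hP D' hD').2
      hPP (abs_posteriorMean_sub_le hN1 (hP D hD).1 (hP D' hD').1 hPP hU hU') ht) hS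

/-! ### Shift of the SGLD mean after one pass. -/

/-- Two affine recursions that differ in the contraction rate of a single step `k`. -/
theorem le_sub_of_contraction_changed_once {e e' : ℕ → ℝ} {a b r c : ℝ} {k n : ℕ} (hkn : k < n)
    (ha1 : a ≤ 1) (hba : b ≤ a) (hr : 0 ≤ r)
    (h0 : e 0 = c) (h0' : e' 0 = c) (he : ∀ j, e (j + 1) = (1 - a) * e j + r)
    (he' : ∀ j < n, e' (j + 1) = (1 - if j = k then b else a) * e' j + r) :
    c * (a - b) * (1 - a) ^ (n - 1) ≤ e' n - e n := by
  have hlow : ∀ j, c * (1 - a) ^ j ≤ e j := by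
    intro j
    induction j with
    | zero => simp [h0]
    | succ j ih =>
      rw [he, pow_succ]
      nlinarith [mul_le_mul_of_nonneg_right ih (sub_nonneg.2 ha1)]
  have heq : ∀ j ≤ k, e' j = e j := by
    intro j hj
    induction j with
    | zero => rw [h0, h0']
    | succ j ih => rw [he' j (by omega), he, if_neg (by omega), ih (by omega)]
  -- Step `k` opens a gap of at least `c (a - b) (1 - a) ^ k`, and each later step shrinks it by `1
  -- - a`. The final exponent `n - 1` does not depend on `k`.
  have hgt : ∀ j, k + 1 ≤ j → j ≤ n → c * (a - b) * (1 - a) ^ (j - 1) ≤ e' j - e j := by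
    intro j hj
    induction j, hj using Nat.le_induction with
    | base =>
      intro _
      rw [he' k hkn, he, if_pos rfl, heq k le_rfl, Nat.add_sub_cancel]
      nlinarith [mul_le_mul_of_nonneg_right (hlow k) (sub_nonneg.2 hba)]
    | succ j hj ih =>
      intro hjn
      rw [he' j (by omega), he, if_neg (by omega), Nat.add_sub_cancel]
      have h1 := mul_le_mul_of_nonneg_right (ih (by omega)) (sub_nonneg.2 ha1)
      have h2 : (1 - a) ^ j = (1 - a) ^ (j - 1) * (1 - a) := by
        rw [← pow_succ, Nat.sub_add_cancel (by omega)]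
      rw [h2]
      linarith
  exact hgt n hkn le_rfl

/-- One step of the mean recursion for a record on the line of slope `c`. -/
theorem sub_sgldMean_succ {n : ℕ} {c η : ℝ} {d : ℕ → ℝ × ℝ} {j : ℕ}
    (hd : (d j).2 = c * (d j).1) :
    c - sgldMean 1 1 η n d (j + 1) =
      (1 - η / 2 * (1 + n * (d j).1 ^ 2)) * (c - sgldMean 1 1 η n d j) + η / 2 * c := by
  rw [sgldMean, hd]
  ring

/-- All records equal `(2, 2 c)`. -/
def lineDatabase (n : ℕ) (c : ℝ) : Fin n → ℝ × ℝ := fun _ => (2, c * 2)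

/-- All records equal `(2, 2 c)`, except that the `i`-th one is `(1, c)`. -/
def changedLineDatabase {n : ℕ} (i : Fin n) (c : ℝ) : Fin n → ℝ × ℝ :=
  fun j => if j = i then (1, c * 1) else (2, c * 2)

theorem hammingDist_lineDatabase_le_one {n : ℕ} (i : Fin n) (c : ℝ) :
    hammingDist (lineDatabase n c) (changedLineDatabase i c) ≤ 1 := by
  rw [hammingDist, Finset.card_le_one]
  intro a ha b hb
  simp only [lineDatabase, changedLineDatabase] at ha hb
  by_cases h1 : a = i <;> by_cases h2 : b = i <;> simp_all

theorem lineDatabase_mem_regressionDomain {n : ℕ} {c γ : ℝ} (hc : 0 < c) :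
    lineDatabase n c ∈ regressionDomain n γ 2 1 c := by
  intro i
  refine ⟨?_, ?_, ?_, ?_, ?_⟩ <;> norm_num [lineDatabase, hc]
  positivity

theorem changedLineDatabase_mem_regressionDomain {n : ℕ} {c γ : ℝ} (i : Fin n) (hc : 0 < c) :
    changedLineDatabase i c ∈ regressionDomain n γ 2 1 c := by
  intro j
  by_cases h : j = i <;>
  · refine ⟨?_, ?_, ?_, ?_, ?_⟩ <;> norm_num [changedLineDatabase, h, hc]
    positivity

theorem sgldMean_line_sub_ge {n : ℕ} (hn : 0 < n) {c : ℝ} (hc : 0 ≤ c)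
    (i : Fin n) (σ σ' : Equiv.Perm (Fin n)) :
    c * (9 / (100 * n)) ≤
      sgldMean 1 1 (2 / (1 + (n : ℝ) * 2 ^ 2 * 1) ^ 2) n
          (fun k => lineDatabase n c (σ ⟨k % n, Nat.mod_lt k hn⟩)) n -
        sgldMean 1 1 (2 / (1 + (n : ℝ) * 2 ^ 2 * 1) ^ 2) n
          (fun k => changedLineDatabase i c (σ' ⟨k % n, Nat.mod_lt k hn⟩)) n := by
  have hn1 : (1 : ℝ) ≤ n := by exact_mod_cast hn
  set A : ℝ := 1 + (n : ℝ) * 2 ^ 2 * 1 with hA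
  have hA1 : 1 ≤ A := by rw [hA]; linarith
  have hA0 : 0 < A := by linarith
  have hη : 2 / A ^ 2 / 2 = 1 / A ^ 2 := by ring
  have ha : 1 / A ^ 2 * (1 + n * 2 ^ 2) = 1 / A := by
    have : (1 + n * 2 ^ 2 : ℝ) = A := by rw [hA]; ring
    rw [this]
    field_simp
  -- The only step of the pass that uses the changed record.
  set k : Fin n := σ'.symm i with hk
  have hmain := le_sub_of_contraction_changed_once
    (e := fun j => c - sgldMean 1 1 (2 / A ^ 2) n
      (fun k => lineDatabase n c (σ ⟨k % n, Nat.mod_lt k hn⟩)) j)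
    (e' := fun j => c - sgldMean 1 1 (2 / A ^ 2) n
      (fun k => changedLineDatabase i c (σ' ⟨k % n, Nat.mod_lt k hn⟩)) j)
    (a := 1 / A) (b := 1 / A ^ 2 * (1 + n)) (r := 1 / A ^ 2 * c) (c := c)
    (k := k) (n := n) k.2 (by rw [div_le_one hA0]; exact hA1)
    (by rw [← ha]; gcongr; linarith) (by positivity) (by simp [sgldMean]) (by simp [sgldMean])
    (fun j => by
      rw [sub_sgldMean_succ rfl, hη]
      simp only [lineDatabase]
      rw [ha])
    (fun j hj => by
      have hmod : (⟨j % n, Nat.mod_lt j hn⟩ : Fin n) = ⟨j, hj⟩ := by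
        simp [Nat.mod_eq_of_lt hj]
      by_cases h : j = k
      · have hi : σ' ⟨j % n, Nat.mod_lt j hn⟩ = i := by
          rw [hmod, ← Equiv.eq_symm_apply]
          exact Fin.ext h
        rw [sub_sgldMean_succ (by simp [changedLineDatabase, hi]), hη, if_pos h]
        simp [changedLineDatabase, hi]
      · have hi : σ' ⟨j % n, Nat.mod_lt j hn⟩ ≠ i := by
          rw [hmod, Ne, ← Equiv.eq_symm_apply]
          exact fun h' => h (congrArg Fin.val h')
        rw [sub_sgldMean_succ (by simp [changedLineDatabase, hi]), hη, if_neg h]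
        simp only [changedLineDatabase, if_neg hi]
        rw [ha])
  -- Bernoulli's inequality with `(n - 1) / A ≤ 1 / 4`, as `A = 1 + 4 n`.
  have hpow : 3 / 4 ≤ (1 - 1 / A) ^ (n - 1) := by
    have h1 := one_add_mul_le_pow (a := -(1 / A)) (by
      have : 1 / A ≤ 1 := by rw [div_le_one hA0]; exact hA1
      linarith) (n - 1)
    rw [Nat.cast_sub hn] at h1
    rw [← sub_eq_add_neg] at h1
    refine le_trans ?_ h1
    have : (n - 1) * (1 / A) ≤ 1 / 4 := by
      rw [mul_one_div, div_le_div_iff₀ hA0 (by norm_num), hA]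
      linarith
    push_cast
    linarith
  -- The difference of rates is `3 n / A ^ 2`, and `A ≤ 5 n`.
  have hab : 3 / (25 * n) ≤ 1 / A - 1 / A ^ 2 * (1 + n) := by
    rw [← ha, ← mul_sub, one_div_mul_eq_div,
      div_le_div_iff₀ (by positivity) (by positivity), hA]
    nlinarith
  calc c * (9 / (100 * n)) = c * (3 / (25 * n)) * (3 / 4) := by ring
    _ ≤ c * (1 / A - 1 / A ^ 2 * (1 + n)) * (1 - 1 / A) ^ (n - 1) := by
        have : (0 : ℝ) ≤ 3 / (25 * n) := by positivity
        gcongr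
        exact mul_nonneg hc (this.trans hab)
    _ ≤ _ := hmain.trans (by linarith)

/-! ### SGLD is not private: separation by a half-line. -/

theorem gaussianReal_setOf_le_le {m s : ℝ} {v : ℝ≥0} (h : m < s) :
    gaussianReal m v {x | s ≤ x} ≤ ENNReal.ofReal (v / (s - m) ^ 2) :=
  (measure_mono fun x (hx : s ≤ x) =>
    (sub_le_sub_right hx m).trans (le_abs_self _)).trans
    (gaussianReal_compl_ball_le m v (sub_pos.2 h))

theorem gaussianReal_setOf_gt_le {m s : ℝ} {v : ℝ≥0} (h : s < m) :
    gaussianReal m v {x | s ≤ x}ᶜ ≤ ENNReal.ofReal (v / (m - s) ^ 2) := by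
  refine (measure_mono fun x hx => ?_).trans (gaussianReal_compl_ball_le m v (sub_pos.2 h))
  have : x < s := by simpa using hx
  exact le_trans (by linarith) (neg_le_abs (x - m))

/-- A bound on every order gives the bound on the uniform mixture of the orders. -/
theorem cyclicSGLDLaw_apply_le {n : ℕ} {R : Type*} (hn : 0 < n) (prior : ℝ → ℝ)
    (lik : R → ℝ → ℝ) (η : ℝ) (T : ℕ) (D : Fin n → R) {S : Set ℝ} {τ : ℝ≥0∞}
    (h : ∀ σ, sgldOrderLaw hn prior lik η D σ T S ≤ τ) :
    cyclicSGLDLaw hn prior lik η T D S ≤ τ := by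
  have hf : ((Nat.factorial n : ℕ) : ℝ≥0∞) ≠ 0 := by exact_mod_cast (Nat.factorial_pos n).ne'
  rw [cyclicSGLDLaw, Measure.smul_apply, Measure.finsetSum_apply, smul_eq_mul]
  calc _ ≤ ((Nat.factorial n : ℕ) : ℝ≥0∞)⁻¹ * ((Nat.factorial n : ℕ) * τ) := by
        gcongr
        refine (Finset.sum_le_card_nsmul _ _ τ fun σ _ => h σ).trans (le_of_eq ?_)
        rw [Finset.card_univ, Fintype.card_perm, Fintype.card_fin, nsmul_eq_mul]
    _ = τ := by
        rw [← mul_assoc, ENNReal.inv_mul_cancel hf (ENNReal.natCast_ne_top _), one_mul]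

theorem cyclicSGLDLaw_univ {n : ℕ} {R : Type*} (hn : 0 < n) (prior : ℝ → ℝ)
    (lik : R → ℝ → ℝ) (η : ℝ) (T : ℕ) (D : Fin n → R)
    (h : ∀ σ, IsProbabilityMeasure (sgldOrderLaw hn prior lik η D σ T)) :
    cyclicSGLDLaw hn prior lik η T D Set.univ = 1 := by
  have hf : ((Nat.factorial n : ℕ) : ℝ≥0∞) ≠ 0 := by exact_mod_cast (Nat.factorial_pos n).ne'
  rw [cyclicSGLDLaw, Measure.smul_apply, Measure.finsetSum_apply, smul_eq_mul]
  simp only [measure_univ, Finset.sum_const, Finset.card_univ, Fintype.card_perm,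
    Fintype.card_fin, nsmul_eq_mul, mul_one]
  exact ENNReal.inv_mul_cancel hf (ENNReal.natCast_ne_top _)

theorem not_isDP_cyclicSGLDLaw_slope {N n : ℕ} (hn : 0 < n) (hnN : n = N ^ 4) {γ δ ε' : ℝ}
    (hδ : 0 < δ) (hδ' : δ < 1 / 2) (hN : (1 + Real.exp ε') * 1000 / N < 1 / 2) {ε'' : ℝ}
    (hε : ε'' < ε') :
    ¬ IsDP (cyclicSGLDLaw hn (slopePrior 1) (slopeLik 1)
        (2 / (1 + (n : ℝ) * 2 ^ 2 * 1) ^ 2) n)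
      (regressionDomain n γ 2 1 ((N : ℝ) ^ 5)) ε'' δ := by
  have hN0 : 0 < N := Nat.pos_of_ne_zero fun h => by simp [h] at hnN; omega
  have hN1 : (1 : ℝ) ≤ N := by exact_mod_cast hN0
  have hn1 : (1 : ℝ) ≤ n := by exact_mod_cast hn
  have hnR : (n : ℝ) = (N : ℝ) ^ 4 := by rw [hnN]; push_cast; rfl
  set c : ℝ := (N : ℝ) ^ 5 with hc
  have hc0 : 0 < c := by positivity
  set η : ℝ := 2 / (1 + (n : ℝ) * 2 ^ 2 * 1) ^ 2 with hη
  have hη0 : 0 ≤ η := by positivity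
  have hηn : n * η ≤ 1 := by
    rw [hη, mul_div_assoc', div_le_one (by positivity)]
    nlinarith
  have hgap : c * (9 / (100 * n)) = 9 / 100 * N := by
    rw [hc, hnR]
    field_simp
  let i : Fin n := ⟨0, hn⟩
  set D := lineDatabase n c with hD
  set D' := changedLineDatabase i c with hD'
  have hrate : ∀ x : ℝ, x ^ 2 ≤ 4 → η / 2 * (1 + n * 1 * x ^ 2) ≤ 1 := by
    intro x hx
    have : (1 + n * 1 * x ^ 2 : ℝ) ≤ 1 + n * 2 ^ 2 * 1 := by nlinarith
    calc η / 2 * (1 + n * 1 * x ^ 2) ≤ η / 2 * (1 + (n : ℝ) * 2 ^ 2 * 1) := by gcongr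
      _ = 1 / (1 + (n : ℝ) * 2 ^ 2 * 1) := by rw [hη]; field_simp
      _ ≤ 1 := by rw [div_le_one (by positivity)]; nlinarith
  have hl := exists_sgldOrderLaw_eq_gaussianReal hn one_pos one_pos hη0 D
    (fun j => hrate _ (by norm_num [hD, lineDatabase]))
  have hl' := exists_sgldOrderLaw_eq_gaussianReal hn one_pos one_pos hη0 D'
    (fun j => hrate _ (by by_cases h : j = i <;> norm_num [hD', changedLineDatabase, h]))
  set m := sgldMean 1 1 η n (fun k => D ((1 : Equiv.Perm (Fin n)) ⟨k % n, Nat.mod_lt k hn⟩)) n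
    with hm
  -- Half of the guaranteed gap `9 / 100 * N`, so both means are at least `9 / 200 * N` from the
  -- threshold.
  set s := m - 9 / 200 * N with hs
  have hbound : ∀ (v : ℝ≥0) (t : ℝ), (v : ℝ) ≤ 1⁻¹ + n * η → 9 / 200 * N ≤ t →
      (v : ℝ) / t ^ 2 ≤ 1000 / N := by
    intro v t hv ht
    have h1 : (v : ℝ) ≤ 2 := by rw [inv_one] at hv; linarith
    have h2 : (9 / 200 * (N : ℝ)) ^ 2 ≤ t ^ 2 := pow_le_pow_left₀ (by positivity) ht 2
    calc (v : ℝ) / t ^ 2 ≤ 2 / (9 / 200 * (N : ℝ)) ^ 2 := by gcongr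
      _ ≤ 1000 / (N : ℝ) := by
        rw [div_le_div_iff₀ (by positivity) (by positivity)]
        nlinarith
  have hup : cyclicSGLDLaw hn (slopePrior 1) (slopeLik 1) η n D' {x | s ≤ x} ≤
      ENNReal.ofReal (1000 / N) := by
    refine cyclicSGLDLaw_apply_le _ _ _ _ _ _ fun σ => ?_
    obtain ⟨v, hv, h⟩ := hl' σ n
    have hg : _ ≤ m - sgldMean 1 1 η n (fun k => D' (σ ⟨k % n, Nat.mod_lt k hn⟩)) n :=
      sgldMean_line_sub_ge hn hc0.le i 1 σ
    rw [hgap] at hg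
    rw [h]
    refine (gaussianReal_setOf_le_le ?_).trans
      (ENNReal.ofReal_le_ofReal (hbound v _ hv ?_)) <;> linarith
  have hdown : cyclicSGLDLaw hn (slopePrior 1) (slopeLik 1) η n D {x | s ≤ x}ᶜ ≤
      ENNReal.ofReal (1000 / N) := by
    refine cyclicSGLDLaw_apply_le _ _ _ _ _ _ fun σ => ?_
    obtain ⟨v, hv, h⟩ := hl σ n
    rw [h]
    -- All records of `D` are equal, so its mean is the same for every `σ`.
    change gaussianReal m v _ ≤ _
    refine (gaussianReal_setOf_gt_le ?_).trans
      (ENNReal.ofReal_le_ofReal (hbound v _ hv ?_)) <;> linarith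
  have hone := cyclicSGLDLaw_univ hn (slopePrior 1) (slopeLik 1) η n D fun σ => by
    obtain ⟨v, -, h⟩ := hl σ n
    rw [h]
    infer_instance
  intro hDP
  have hτ : (0 : ℝ) ≤ 1000 / N := by positivity
  have h1 := hDP D (lineDatabase_mem_regressionDomain hc0) D'
    (changedLineDatabase_mem_regressionDomain i hc0) (hammingDist_lineDatabase_le_one i c)
    {x | s ≤ x} (measurableSet_le measurable_const measurable_id)
  -- Privacy would bound the total mass 1 by `δ < 1 / 2` plus tails that `hN` makes smaller than `1
  -- / 2`.
  have h2 : (1 : ℝ≥0∞) ≤ ENNReal.ofReal (Real.exp ε'' * (1000 / N) + δ + 1000 / N) := by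
    rw [ENNReal.ofReal_add (by positivity) hτ, ENNReal.ofReal_add (by positivity) hδ.le,
      ENNReal.ofReal_mul (Real.exp_pos _).le, ← hone, ← Set.union_compl_self {x | s ≤ x}]
    refine (measure_union_le _ _).trans (add_le_add (h1.trans ?_) hdown)
    gcongr
  rw [ENNReal.one_le_ofReal] at h2
  have h3 : Real.exp ε'' * (1000 / N) ≤ Real.exp ε' * (1000 / N) := by gcongr
  have h4 : (1 + Real.exp ε') * 1000 / N = 1000 / N + Real.exp ε' * (1000 / N) := by ring
  linarith

theorem theorem1 (δ ε ε' : ℝ) (hδ : 0 < δ) (hδ' : δ < 1 / 2) (hε : 0 < ε) :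
    ∃ (α β xl xh c γ : ℝ) (n : ℕ) (hn : 0 < n),
      0 < α ∧ 0 < β ∧ 0 < xl ∧ xl ≤ xh ∧ 0 < c ∧ 0 < γ ∧ γ < 1 / 2 ∧ 3 < xh ^ 2 * β ∧
      IsDP (posteriorLaw (slopePrior α) (slopeLik β)) (regressionDomain n γ xh xl c) ε δ ∧
      ∃ T : ℕ, 0 < T ∧ ∀ ε'' : ℝ, ε'' < ε' →
        ¬ IsDP (cyclicSGLDLaw hn (slopePrior α) (slopeLik β)
              (2 / (α + (n : ℝ) * xh ^ 2 * β) ^ 2) T)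
            (regressionDomain n γ xh xl c) ε'' δ := by
  -- The Chebyshev tail at `K` standard deviations has mass at most `1 / K ^ 2 = δ`.
  set K : ℝ := (√δ)⁻¹ with hK
  have hKpos : 0 < K := by positivity
  have hKδ : (K ^ 2)⁻¹ ≤ δ := by rw [hK, inv_pow, inv_inv, Real.sq_sqrt hδ.le]
  have hlim (C b : ℝ) (hb : 0 < b) : ∀ᶠ N : ℕ in Filter.atTop, C / (N : ℝ) < b :=
    (tendsto_const_div_atTop_nhds_zero_nat C).eventually_lt_const hb
  obtain ⟨N, ⟨hN1, hN2⟩, hN3⟩ := (((hlim (K ^ 2 + 70 * K + 500) (ε * 2⁻¹) (by positivity)).and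
    (hlim ((1 + Real.exp ε') * 1000) (1 / 2) (by norm_num))).and
    (Filter.eventually_ge_atTop 1)).exists
  have hn : 0 < N ^ 4 := pow_pos hN3 4
  have hN0 : (0 : ℝ) < N := by exact_mod_cast hN3
  have hγ : ((N ^ 4 : ℕ) : ℝ) ^ (1 / 4 : ℝ) = N := by
    rw [Nat.cast_pow, ← Real.rpow_natCast, ← Real.rpow_mul hN0.le]
    norm_num
  exact ⟨1, 1, 1, 2, (N : ℝ) ^ 5, 1 / 4, N ^ 4, hn, one_pos, one_pos, one_pos, one_le_two,
    by positivity, by norm_num, by norm_num, by norm_num,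
    isDP_posteriorLaw_slope hN3 rfl hγ hKpos hKδ hN1.le, N ^ 4, hn,
    fun ε'' h => not_isDP_cyclicSGLDLaw_slope hn rfl hδ hδ' hN2 h⟩
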